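/- A circuit over $n$ variables is a sequence of gates, each computing a boolean function of finite arity; the inputs of a gate may be constants, variables, negated variables, or earlier gates, and the output is any one of these. Its size is its number of gates and its depth is the largest number of gates on a path to the output. A (non-uniform) circuit class $\mathcal{C}$ is given by a collection of allowed gate sets, such that all gates of a circuit family come from one of these sets, and by a depth restriction, which is one of: depth at most $d$ for a fixed $d$; depth $O((\log n)^i)$ for a fixed $i \geq 0$; no restriction. This includes $\mathsf{AC}^0$, $\mathsf{ACC}$, $\mathsf{TC}^0$, $\mathsf{NC}^1$, $\mathsf{P}/\mathsf{poly}$ and, for example, $\mathsf{TC}^0_2$. A property of boolean functions is a set $\mathcal{P}$ of functions $f_n : \{0,1\}^n \rightarrow \{0,1\}$, $n \in \mathbb{N}$. The truth table $tt(f_n) \in \{0,1\}^{2^n}$ lists the values of $f_n$ on all inputs in lexicographic order. For $\Gamma \in \{\mathsf{P}, \mathsf{NP}\}$, $\mathcal{P}$ is a $\Gamma$-property if the language $\{tt(f_n) \mid n \in \mathbb{N},\ f_n \in \mathcal{P}\} \subseteq \{0,1\}^*$ is in $\Gamma$. The property $\mathcal{P}$ is useful against $\mathcal{C}[\mathsf{poly}]$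 if, for every gate set and every depth bound allowed in $\mathcal{C}$ (with the constant in the $O(\cdot)$ fixed) and for every $k \in \mathbb{N}$, there are infinitely many positive integers $n$ such that (1) $f_n \in \mathcal{P}$ for at least one function $f_n : \{0,1\}^n \rightarrow \{0,1\}$, and (2) $g_n \notin \mathcal{P}$ for every function $g_n : \{0,1\}^n \rightarrow \{0,1\}$ that is computed by a circuit over this gate set, within this depth bound, and of size at most $n^k$. Theorem. Let $\mathcal{C}$ be a circuit class. If there exists an $\mathsf{NP}$-property that is useful against $\mathcal{C}[\mathsf{poly}]$, then there exists a $\mathsf{P}$-property that is useful against $\mathcal{C}[\mathsf{poly}]$. -/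

import Mathlib

/-! ### Boolean circuits -/

/-- A gate type: a boolean function of some finite arity. -/
structure Gate where
  arity : ℕ
  fn : (Fin arity → Bool) → Bool

/-- What an input of a gate may be connected to, in a circuit over `n` variables in which `s` gates
are already present: a constant, a variable or its negation, or one of these gates. -/
inductive Source (n s : ℕ) : Type
  | const (b : Bool) : Source n s
  | var (j : Fin n) : Source n s
  | negVar (j : Fin n) : Source n s
  | gate (j : Fin s) : Source n s

/-- The value of a source on the input `x`, where `v` holds the values of the gates. -/
def Source.value {n s : ℕ} (x : Fin n → Bool) (v : Fin s → Bool) : Source n s → Bool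
  | .const b => b
  | .var j => x j
  | .negVar j => !(x j)
  | .gate j => v j

/-- The depth of a source, where `d` holds the depths of the gates. -/
def Source.depth {n s : ℕ} (d : Fin s → ℕ) : Source n s → ℕ
  | .const _ => 0
  | .var _ => 0
  | .negVar _ => 0
  | .gate j => d j

/-- Circuits over `n` variables with exactly `s` gates, listed in a topological order. -/
inductive Circuit (n : ℕ) : ℕ → Type
  | nil : Circuit n 0
  | snoc {s : ℕ} (c : Circuit n s) (g : Gate) (src : Fin g.arity → Source n s) : Circuit n (s + 1)

namespace Circuit

/-- The values of all gates on the input `x`. -/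
def values {n : ℕ} (x : Fin n → Bool) : {s : ℕ} → Circuit n s → Fin s → Bool
  | _, .nil => Fin.elim0
  | _, .snoc c g src =>
      Fin.snoc (α := fun _ => Bool) (c.values x) (g.fn fun a => (src a).value x (c.values x))

/-- The depths of all gates: the number of gates on a longest path that ends in the gate. -/
def depths {n : ℕ} : {s : ℕ} → Circuit n s → Fin s → ℕ
  | _, .nil => Fin.elim0
  | _, .snoc c _ src =>
      Fin.snoc (α := fun _ => ℕ) c.depths ((Finset.univ.sup fun a => (src a).depth c.depths) + 1)

/-- All gates of the circuit are taken from the gate set `B`. -/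
def Over (B : Set Gate) {n : ℕ} : {s : ℕ} → Circuit n s → Prop
  | _, .nil => True
  | _, .snoc c g _ => c.Over B ∧ g ∈ B

end Circuit

/-- `f` is computed by a circuit with gates from `B`, of depth at most `d` and with at most `s`
gates. -/
def HasCircuit (B : Set Gate) (d : ℕ∞) (s : ℕ) {n : ℕ} (f : (Fin n → Bool) → Bool) : Prop :=
  ∃ s' ≤ s, ∃ (c : Circuit n s') (out : Source n s'),
    c.Over B ∧ (out.depth c.depths : ℕ∞) ≤ d ∧ ∀ x, out.value x (c.values x) = f x

/-! ### Circuit classes -/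

/-- The depth restrictions used to define circuit classes: a fixed depth `d`, depth
`O((log n) ^ i)` (constant depth when `i = 0`), or no restriction. -/
inductive DepthRegime : Type
  | fixed (d : ℕ) : DepthRegime
  | bigOLogPow (i : ℕ) : DepthRegime
  | unbounded : DepthRegime

/-- The depth bounds, as functions of the number `n` of variables, that a regime admits. -/
def DepthRegime.bounds : DepthRegime → Set (ℕ → ℕ∞)
  | .fixed d => {fun _ => (d : ℕ∞)}
  | .bigOLogPow i => {D | ∃ a : ℕ, D = fun n => ((a * (Nat.log 2 n + 1) ^ i : ℕ) : ℕ∞)}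
  | .unbounded => {fun _ => ⊤}

/-- A (non-uniform) circuit class: circuit families whose gates all come from one of the gate sets
in `gateSets`, and whose depth obeys `regime`. -/
structure CircuitClass where
  gateSets : Set (Set Gate)
  regime : DepthRegime

/-- AND gates of any arity. -/
def andGates : Set Gate := {g | ∀ y, g.fn y = true ↔ ∀ i, y i = true}

/-- OR gates of any arity. -/
def orGates : Set Gate := {g | ∀ y, g.fn y = true ↔ ∃ i, y i = true}

/-- The NOT gate. -/
def notGates : Set Gate := {g | g.arity = 1 ∧ ∀ y, g.fn y = true ↔ ∀ i, y i = false}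

/-- `MOD_q` gates of any arity. -/
def modGates (q : ℕ) : Set Gate :=
  {g | ∀ y, g.fn y = true ↔ q ∣ (Finset.univ.filter fun i => y i = true).card}

/-- Gates that compute linear threshold functions, with arbitrary weights. -/
def thresholdGates : Set Gate :=
  {g | ∃ (w : Fin g.arity → ℝ) (θ : ℝ), ∀ y,
    g.fn y = true ↔ θ ≤ ∑ i, if y i = true then w i else 0}

/-- AND, OR and NOT gates of arbitrary arity. -/
def unboundedFanInGates : Set Gate := andGates ∪ orGates ∪ notGates

/-- AND, OR and NOT gates of arity at most two. -/
def fanInTwoGates : Set Gate := {g | g ∈ unboundedFanInGates ∧ g.arity ≤ 2}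

namespace CircuitClass

/-- `AC⁰`: constant depth, AND, OR, NOT gates of unbounded fan-in. -/
def AC0 : CircuitClass := ⟨{unboundedFanInGates}, .bigOLogPow 0⟩

/-- `ACC`: as `AC⁰`, with `MOD_q` gates for some constant `q`. -/
def ACC : CircuitClass := ⟨{B | ∃ q, 2 ≤ q ∧ B = unboundedFanInGates ∪ modGates q}, .bigOLogPow 0⟩

/-- `TC⁰`: constant depth, linear threshold gates. -/
def TC0 : CircuitClass := ⟨{thresholdGates}, .bigOLogPow 0⟩

/-- `NC¹`: logarithmic depth, AND, OR, NOT gates of fan-in at most two. -/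
def NC1 : CircuitClass := ⟨{fanInTwoGates}, .bigOLogPow 1⟩

/-- `P/poly` (when the size is polynomial): AND, OR, NOT gates of fan-in at most two. -/
def PPoly : CircuitClass := ⟨{fanInTwoGates}, .unbounded⟩

end CircuitClass

/-! ### Properties of boolean functions -/

/-- A property of boolean functions: a set of boolean functions `{0,1}ⁿ → {0,1}`, `n ∈ ℕ`. -/
abbrev BooleanProperty : Type := (n : ℕ) → Set ((Fin n → Bool) → Bool)

/-- The truth table of `f`: its `2 ^ n` values, on all inputs in lexicographic order. -/
def truthTable {n : ℕ} (f : (Fin n → Bool) → Bool) : List Bool :=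
  List.ofFn fun i : Fin (2 ^ n) => f fun j => (i : ℕ).testBit (Fin.rev j)

/-- The language of the truth tables of the functions that have the property. -/
def BooleanProperty.language (P : BooleanProperty) : Language Bool :=
  {w | ∃ (n : ℕ) (f : (Fin n → Bool) → Bool), f ∈ P n ∧ w = truthTable f}

/-- `P` is useful against `C[poly]`: for every choice of a gate set and a depth bound allowed in `C`,
and of an exponent `k`, there are infinitely many `n` such that some `n`-variate function has the
property and no `n`-variate function with circuits of size `n ^ k` of this kind has it. -/
def BooleanProperty.UsefulAgainstPoly (P : BooleanProperty) (C : CircuitClass) : Prop :=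
  ∀ B ∈ C.gateSets, ∀ D ∈ C.regime.bounds, ∀ k : ℕ,
    {n : ℕ | 0 < n ∧ (∃ f, f ∈ P n) ∧
      ∀ g : (Fin n → Bool) → Bool, HasCircuit B (D n) (n ^ k) g → g ∉ P n}.Infinite

/-! ### The complexity classes `P` and `NP` -/

/-- `L ∈ P`: some multi-stack Turing machine decides `L` in polynomial time. -/
def InP (L : Language Bool) : Prop :=
  ∃ f : List Bool → Bool,
    Nonempty (Turing.TM2ComputableInPolyTime (fun x : List Bool => x) Computability.encodeBool f) ∧
      ∀ x, x ∈ L ↔ f x = true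

/-- The string `x # w`; the separator `#` is `none`. -/
def encodePair (p : List Bool × List Bool) : List (Option Bool) :=
  p.1.map some ++ none :: p.2.map some

/-- `L ∈ NP`: there is a polynomial-time verifier `V` with witnesses of polynomial length. -/
def InNP (L : Language Bool) : Prop :=
  ∃ (V : List Bool × List Bool → Bool) (p : Polynomial ℕ),
    Nonempty (Turing.TM2ComputableInPolyTime encodePair Computability.encodeBool V) ∧
      ∀ x, x ∈ L ↔ ∃ w : List Bool, w.length ≤ p.eval x.length ∧ V (x, w) = true

/-- `P` is a `P`-property. -/
def BooleanProperty.IsPProperty (P : BooleanProperty) : Prop := InP P.language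

/-- `P` is an `NP`-property. -/
def BooleanProperty.IsNPProperty (P : BooleanProperty) : Prop := InNP P.language

/-!
A property in `NP` is traded for one in `P` by storing the witness in the function itself. Let `V` be
a verifier for the truth tables of `P`, with witnesses of length at most `q N` for tables of length
`N`. A function `g` in `c * n + 1` variables has the new property if its truth table, read as
`(2 ^ n) ^ c` pairs of bits, has the form `x # w # padding`, where `|x| = 2 ^ n`, `|w| ≤ q |x|` and `V`
accepts `(x, w)`. The second bit of each pair marks the extent of `x` and of `w`, so the parts can be
found without knowing `n`; that `|x|` is a power of two need not be checked, since `V` accepts only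
truth tables.

*Usefulness.* The table `x` occupies the even positions of an initial segment of the truth table of
`g`, so the function with truth table `x` arises from `g` by fixing variables to `0`
(`eq_of_tablePart_eq`). Fixing variables changes neither the size nor the depth of a circuit nor its
gates (`HasCircuit.restrict`). As `c * n + 1 ≤ n ^ (c + 1)` for `n ≥ 2`, size and depth bounds in
terms of `c * n + 1` are bounds of the same kind in terms of `n` (`DepthRegime.exists_bound`). Hence if
no function of `P` in `n` variables has small circuits, then no function with the new property in
`c * n + 1` variables has. For large enough `c` there is room for a witness (`exists_eval_le_pow`,
`exists_padding`), so such functions exist whenever `P` has one in `n` variables.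

*Complexity.* A stack machine splits its input into `x` and `w`, compares the lengths with `|x| ^ c`
and `q |x|`, computed in unary by Horner's rule, and then runs the machine for `V` on `x # w`. If a
comparison fails, it runs `V` on the empty table with the empty witness, which `V` rejects because
truth tables are nonempty. The splitting is written in a small structured language of stack programs
(`StackProg`, with cost semantics `Exec`); `Exec.reachesIn` says that compiled programs run
accordingly, `nonempty_computable_comp` puts such a program in front of a polynomial-time machine, and
`exists_exec_parse` is the program needed here.
-/

/-! ### Stack programs -/

/-- The working stacks of a stack program; all of them hold bits. Those from `blocks` on, except
`temp`, hold numbers in unary: `blocks` the number of pairs of input bits, `count` the length of the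
witness, and `acc` and `spare` intermediate results. -/
inductive WorkStack : Type
  | input | table | witness | blocks | count | acc | spare | temp
  deriving DecidableEq

instance : Fintype WorkStack :=
  ⟨{.input, .table, .witness, .blocks, .count, .acc, .spare, .temp}, fun k => by cases k <;> simp⟩

/-- The finite control of a stack program. The register `last` receives the result of each `pop`,
`saved` holds one further bit, `phase` says which segment of the input is being read, and `bad` is
raised when the input is found to be malformed. -/
structure Registers : Type where
  last : Option Bool
  saved : Bool
  phase : Fin 3
  bad : Bool
  deriving DecidableEq, Fintype

/-- The registers at the start and at the end of a computation. -/
def Registers.init : Registers := ⟨none, false, 0, false⟩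

/-- The memory of a stack program: the registers, the working stacks, and a write-only output
stack. -/
structure Store : Type where
  reg : Registers
  input : List Bool
  table : List Bool
  witness : List Bool
  blocks : List Bool
  count : List Bool
  acc : List Bool
  spare : List Bool
  temp : List Bool
  out : List (Option Bool)

namespace Store

/-- The contents of a working stack. -/
def get (s : Store) : WorkStack → List Bool
  | .input => s.input
  | .table => s.table
  | .witness => s.witness
  | .blocks => s.blocks
  | .count => s.count
  | .acc => s.acc
  | .spare => s.spare
  | .temp => s.temp

/-- Replace the contents of a working stack. -/
def set (s : Store) : WorkStack → List Bool → Store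
  | .input, l => { s with input := l }
  | .table, l => { s with table := l }
  | .witness, l => { s with witness := l }
  | .blocks, l => { s with blocks := l }
  | .count, l => { s with count := l }
  | .acc, l => { s with acc := l }
  | .spare, l => { s with spare := l }
  | .temp, l => { s with temp := l }

/-- Pop a working stack into the register `last`, which becomes `none` if the stack is empty. -/
def pop (s : Store) (k : WorkStack) : Store :=
  { s.set k (s.get k).tail with reg := { s.reg with last := (s.get k).head? } }

/-- The memory with input `y` and everything else empty. -/
def start (y : List Bool) : Store := ⟨.init, y, [], [], [], [], [], [], [], []⟩

/-- The memory with output `o` and everything else empty. -/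
def finish (o : List (Option Bool)) : Store := ⟨.init, [], [], [], [], [], [], [], [], o⟩

theorem get_set (s : Store) (k : WorkStack) (l : List Bool) :
    (s.set k l).get = Function.update s.get k l := by
  funext k'
  cases k <;> cases k' <;> rfl

theorem set_reg (s : Store) (k : WorkStack) (l : List Bool) : (s.set k l).reg = s.reg := by
  cases k <;> rfl

theorem set_out (s : Store) (k : WorkStack) (l : List Bool) : (s.set k l).out = s.out := by
  cases k <;> rfl

end Store

/-- Structured programs over a `Store`. The program `loop k p` pops `k` and runs `p` until the stack
`k` is found empty. -/
inductive StackProg : Type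
  | push (k : WorkStack) (f : Registers → Bool) : StackProg
  | pop (k : WorkStack) : StackProg
  | load (f : Registers → Registers) : StackProg
  | emit (f : Registers → Option Bool) : StackProg
  | seq (p q : StackProg) : StackProg
  | ite (c : Registers → Bool) (p q : StackProg) : StackProg
  | loop (k : WorkStack) (p : StackProg) : StackProg

/-- `Exec p s s' t`: started in `s`, the program `p` stops in `s'` after at most `t` steps. -/
inductive Exec : StackProg → Store → Store → ℕ → Prop
  | push (k f s) : Exec (.push k f) s (s.set k (f s.reg :: s.get k)) 1
  | pop (k s) : Exec (.pop k) s (s.pop k) 1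
  | load (f s) : Exec (.load f) s { s with reg := f s.reg } 1
  | emit (f s) : Exec (.emit f) s { s with out := f s.reg :: s.out } 1
  | seq {p q s s' s'' t t'} (h : Exec p s s' t) (h' : Exec q s' s'' t') :
      Exec (.seq p q) s s'' (t + t')
  | ite_true {c p q s s' t} (hc : c s.reg = true) (h : Exec p s s' t) :
      Exec (.ite c p q) s s' (t + 1)
  | ite_false {c p q s s' t} (hc : c s.reg = false) (h : Exec q s s' t) :
      Exec (.ite c p q) s s' (t + 1)
  | loop_nil {k p s} (hk : s.get k = []) : Exec (.loop k p) s (s.pop k) 1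
  | loop_cons {k p s s' s'' t t'} (hk : s.get k ≠ []) (h : Exec p (s.pop k) s' t)
      (h' : Exec (.loop k p) s' s'' t') : Exec (.loop k p) s s'' (t + t' + 1)
  | mono {p s s' t t'} (h : Exec p s s' t) (ht : t ≤ t') : Exec p s s' t'

/-! ### Compiling stack programs to stack machines -/

open Turing

namespace StackProg

/-- The labels of a compiled program. -/
def Label : StackProg → Type
  | push _ _ | pop _ | load _ | emit _ => Unit
  | seq p q => p.Label ⊕ q.Label
  | ite _ p q => Option (p.Label ⊕ q.Label)
  | loop _ p => Option p.Label

/-- A program has finitely many labels. -/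
@[reducible]
def labelFintype : (p : StackProg) → Fintype p.Label
  | push _ _ | pop _ | load _ | emit _ => inferInstanceAs (Fintype Unit)
  | seq p q => @instFintypeSum _ _ p.labelFintype q.labelFintype
  | ite _ p q =>
      @instFintypeOption _ (@instFintypeSum _ _ p.labelFintype q.labelFintype)
  | loop _ p => @instFintypeOption _ p.labelFintype

/-- The label at which a program starts. -/
def entry : (p : StackProg) → p.Label
  | push _ _ | pop _ | load _ | emit _ => ()
  | seq p _ => Sum.inl p.entry
  | ite _ _ _ => none
  | loop _ _ => none

end StackProg

section Compile

variable (V : FinTM2)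

/-- The stack alphabets of a machine that has the working stacks besides the stacks of `V`. -/
abbrev CombinedAlphabet : WorkStack ⊕ V.K → Type := Sum.elim (fun _ => Bool) V.Γ

/-- The contents of all stacks, given those of the working stacks and those of `V`. -/
def combinedStacks (w : WorkStack → List Bool) (S : ∀ k, List (V.Γ k)) :
    ∀ k, List (CombinedAlphabet V k)
  | .inl k => w k
  | .inr k => S k

theorem update_combinedStacks_inl (w : WorkStack → List Bool) (S : ∀ k, List (V.Γ k))
    (k : WorkStack) (l : List Bool) :
    Function.update (combinedStacks V w S) (.inl k) l =
      combinedStacks V (Function.update w k l) S := by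
  funext k'
  rcases k' with k' | k'
  · by_cases h : k' = k
    · subst h
      exact (Function.update_self (Sum.inl k') _ _).trans (Function.update_self k' l w).symm
    · refine (Function.update_of_ne (fun h' => h (Sum.inl.inj h')) _ _).trans (Eq.symm ?_)
      exact Function.update_of_ne h l w
  · exact Function.update_of_ne (fun h => by cases h) _ _

theorem update_combinedStacks_inr (w : WorkStack → List Bool) (S : ∀ k, List (V.Γ k))
    (k : V.K) (l : List (V.Γ k)) :
    Function.update (combinedStacks V w S) (.inr k) l =
      combinedStacks V w (Function.update S k l) := by
  funext k'
  rcases k' with k' | k'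
  · exact Function.update_of_ne (fun h => by cases h) _ _
  · by_cases h : k' = k
    · subst h
      exact (Function.update_self (Sum.inr k') _ _).trans (Function.update_self k' l S).symm
    · refine (Function.update_of_ne (fun h' => h (Sum.inr.inj h')) _ _).trans (Eq.symm ?_)
      exact Function.update_of_ne h l S

theorem update_initList_stk (a : V.Γ V.k₀) (l : List (V.Γ V.k₀)) :
    Function.update (initList V l).stk V.k₀ (a :: (initList V l).stk V.k₀) =
      (initList V (a :: l)).stk := by
  funext k
  by_cases h : k = V.k₀
  · subst h; simp [initList]
  · simp [initList, h]

variable {V} (e : V.Γ V.k₀ ≃ Option Bool)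

namespace StackProg

/-- The code of a program, in a machine whose labels contain those of the program by `inj`; control
passes to `exit` when the program stops. The output stack of the program is the input stack of `V`,
and the internal state of `V` is left alone. -/
def code {Λ : Type} : (p : StackProg) → (p.Label → Λ) → Λ → p.Label →
    TM2.Stmt (CombinedAlphabet V) Λ (Registers × V.σ)
  | push k f, _, exit, _ => .push (.inl k) (fun v => f v.1) (.goto fun _ => exit)
  | pop k, _, exit, _ =>
      .pop (.inl k) (fun v a => ({ v.1 with last := a }, v.2)) (.goto fun _ => exit)
  | load f, _, exit, _ => .load (fun v => (f v.1, v.2)) (.goto fun _ => exit)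
  | emit f, _, exit, _ => .push (.inr V.k₀) (fun v => e.symm (f v.1)) (.goto fun _ => exit)
  | seq p q, inj, exit, l =>
      match l with
      | .inl l => p.code (inj ∘ Sum.inl) (inj (.inr q.entry)) l
      | .inr l => q.code (inj ∘ Sum.inr) exit l
  | ite c p q, inj, exit, l =>
      match l with
      | none => .goto fun v =>
          if c v.1 then inj (some (.inl p.entry)) else inj (some (.inr q.entry))
      | some (.inl l) => p.code (inj ∘ some ∘ Sum.inl) exit l
      | some (.inr l) => q.code (inj ∘ some ∘ Sum.inr) exit l
  | loop k p, inj, exit, l =>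
      match l with
      | none => .pop (.inl k) (fun v a => ({ v.1 with last := a }, v.2))
          (.goto fun v => if v.1.last.isSome then inj (some p.entry) else exit)
      | some l => p.code (inj ∘ some) (inj none) l

end StackProg

/-- The configuration of a compiled program at the label `l`, with memory `s`. -/
def Store.cfg {Λ : Type} (s : Store) (l : Λ) :
    TM2.Cfg (CombinedAlphabet V) Λ (Registers × V.σ) :=
  ⟨some l, (s.reg, V.initialState),
    combinedStacks V s.get (initList V (s.out.map e.symm)).stk⟩

/-- `f` leads from `a` to `b` in at most `t` steps. -/
def ReachesIn {α : Type} (f : α → Option α) (a b : α) (t : ℕ) : Prop :=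
  ∃ n ≤ t, (flip bind f)^[n] (some a) = some b

theorem ReachesIn.trans {α : Type} {f : α → Option α} {a b c : α} {t t' : ℕ}
    (h : ReachesIn f a b t) (h' : ReachesIn f b c t') : ReachesIn f a c (t + t') := by
  obtain ⟨n, hn, h⟩ := h
  obtain ⟨n', hn', h'⟩ := h'
  exact ⟨n' + n, by omega, by rw [Function.iterate_add_apply, h, h']⟩

theorem ReachesIn.single {α : Type} {f : α → Option α} {a b : α} (h : f a = some b) :
    ReachesIn f a b 1 := ⟨1, le_rfl, h⟩

theorem Store.get_pop (s : Store) (k : WorkStack) :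
    (s.pop k).get = Function.update s.get k (s.get k).tail :=
  s.get_set k _

theorem Store.cfg_pop {Λ : Type} (s : Store) (k : WorkStack) (l : Λ) :
    (s.pop k).cfg e l = ⟨some l, ({ s.reg with last := (s.get k).head? }, V.initialState),
      Function.update (combinedStacks V s.get (initList V (s.out.map e.symm)).stk) (.inl k)
        (s.get k).tail⟩ := by
  rw [update_combinedStacks_inl, ← Store.get_pop]
  simp only [Store.cfg, Store.pop, Store.set_out]

/-- A compiled program runs as its semantics says. -/
theorem Exec.reachesIn {Λ : Type} (M : Λ → TM2.Stmt (CombinedAlphabet V) Λ (Registers × V.σ))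
    {p : StackProg} {s s' : Store} {t : ℕ} (h : Exec p s s' t) :
    ∀ (inj : p.Label → Λ) (exit : Λ), (∀ l, M (inj l) = p.code e inj exit l) →
      ReachesIn (TM2.step M) (s.cfg e (inj p.entry)) (s'.cfg e exit) t := by
  induction h with
  | push k f s =>
    intro inj exit hM
    apply ReachesIn.single
    simp only [Store.cfg, hM, TM2.step, StackProg.code, TM2.stepAux, Store.set_reg, Store.set_out,
      Store.get_set]
    rw [← update_combinedStacks_inl]
    rfl
  | pop k s =>
    intro inj exit hM
    apply ReachesIn.single
    rw [Store.cfg_pop]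
    simp only [Store.cfg, hM, TM2.step, StackProg.code, TM2.stepAux]
    rfl
  | load f s =>
    intro inj exit hM
    apply ReachesIn.single
    simp only [Store.cfg, hM, TM2.step, StackProg.code, TM2.stepAux]
    rfl
  | emit f s =>
    intro inj exit hM
    apply ReachesIn.single
    simp only [Store.cfg, hM, StackProg.code, TM2.step, TM2.stepAux,
      List.map_cons, ← update_initList_stk]
    rw [← update_combinedStacks_inr]
    rfl
  | @seq p q s s' s'' t t' _ _ ih ih' =>
    intro inj exit hM
    exact (ih (inj ∘ Sum.inl) (inj (.inr q.entry)) fun l => hM (Sum.inl l)).trans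
      (ih' (inj ∘ Sum.inr) exit fun l => hM (Sum.inr l))
  | @ite_true c p q s s' t hc _ ih =>
    intro inj exit hM
    rw [add_comm]
    refine (ReachesIn.single ?_).trans
      (ih (inj ∘ some ∘ Sum.inl) exit fun l => hM (some (Sum.inl l)))
    simp only [Store.cfg, hM, TM2.step]
    simp only [StackProg.code, StackProg.entry, TM2.stepAux, hc]
    rfl
  | @ite_false c p q s s' t hc _ ih =>
    intro inj exit hM
    rw [add_comm]
    refine (ReachesIn.single ?_).trans
      (ih (inj ∘ some ∘ Sum.inr) exit fun l => hM (some (Sum.inr l)))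
    simp only [Store.cfg, hM, TM2.step]
    simp only [StackProg.code, StackProg.entry, TM2.stepAux, hc]
    rfl
  | @loop_nil k p s hk =>
    intro inj exit hM
    apply ReachesIn.single
    have hk' : combinedStacks V s.get (initList V (s.out.map e.symm)).stk (.inl k) = [] := hk
    rw [Store.cfg_pop]
    simp only [Store.cfg, hM, TM2.step]
    simp only [StackProg.code, StackProg.entry, TM2.stepAux, hk, hk']
    rfl
  | @loop_cons k p s s' s'' t t' hk _ _ ih ih' =>
    intro inj exit hM
    rw [add_comm]
    refine (ReachesIn.single ?_).trans
      ((ih (inj ∘ some) (inj none) fun l => hM (some l)).trans (ih' inj exit hM))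
    obtain ⟨a, l, hl⟩ := List.exists_cons_of_ne_nil hk
    have hl' : combinedStacks V s.get (initList V (s.out.map e.symm)).stk (.inl k) = a :: l := hl
    rw [Store.cfg_pop]
    simp only [Store.cfg, hM, TM2.step]
    simp only [StackProg.code, StackProg.entry, TM2.stepAux, hl, hl']
    rfl
  | mono _ ht ih =>
    intro inj exit hM
    obtain ⟨n, hn, h⟩ := ih inj exit hM
    exact ⟨n, hn.trans ht, h⟩

end Compile

/-! ### Running a machine after a stack program -/

section Preprocess

variable {V : FinTM2}

/-- A statement of `V`, in a machine that also has working stacks and registers. -/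
def liftStmt {Λ : Type} (inj : V.Λ → Λ) :
    TM2.Stmt V.Γ V.Λ V.σ → TM2.Stmt (CombinedAlphabet V) Λ (Registers × V.σ)
  | .push k f q => .push (.inr k) (fun v => f v.2) (liftStmt inj q)
  | .peek k f q => .peek (.inr k) (fun v a => (v.1, f v.2 a)) (liftStmt inj q)
  | .pop k f q => .pop (.inr k) (fun v a => (v.1, f v.2 a)) (liftStmt inj q)
  | .load f q => .load (fun v => (v.1, f v.2)) (liftStmt inj q)
  | .branch c q q' => .branch (fun v => c v.2) (liftStmt inj q) (liftStmt inj q')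
  | .goto l => .goto fun v => inj (l v.2)
  | .halt => .halt

/-- A configuration of `V`, in a machine whose working stacks are empty and whose registers are in
their initial state. -/
def liftCfg {Λ : Type} (inj : V.Λ → Λ) (c : TM2.Cfg V.Γ V.Λ V.σ) :
    TM2.Cfg (CombinedAlphabet V) Λ (Registers × V.σ) :=
  ⟨c.l.map inj, (.init, c.var), combinedStacks V (fun _ => []) c.stk⟩

theorem stepAux_liftStmt {Λ : Type} (inj : V.Λ → Λ) (q : TM2.Stmt V.Γ V.Λ V.σ) (v : V.σ)
    (S : ∀ k, List (V.Γ k)) :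
    TM2.stepAux (liftStmt inj q) (.init, v) (combinedStacks V (fun _ => []) S) =
      liftCfg inj (TM2.stepAux q v S) := by
  induction q generalizing v S with
  | push k f q ih =>
    simp only [liftStmt, TM2.stepAux]
    rw [← ih, ← update_combinedStacks_inr]
    rfl
  | peek k f q ih =>
    rw [TM2.stepAux, ← ih, liftStmt, TM2.stepAux]
    rfl
  | pop k f q ih =>
    simp only [liftStmt, TM2.stepAux]
    rw [← ih, ← update_combinedStacks_inr]
    rfl
  | load f q ih =>
    rw [TM2.stepAux, ← ih, liftStmt, TM2.stepAux]
  | branch c q q' ih ih' =>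
    rw [TM2.stepAux, liftStmt, TM2.stepAux]
    cases hc : c v
    · simpa [hc] using ih' v S
    · simpa [hc] using ih v S
  | goto l => rfl
  | halt => rfl

theorem iterate_liftCfg {Λ : Type} (inj : V.Λ → Λ)
    (M : Λ → TM2.Stmt (CombinedAlphabet V) Λ (Registers × V.σ))
    (hM : ∀ l, M (inj l) = liftStmt inj (V.m l)) (n : ℕ) (c : Option (TM2.Cfg V.Γ V.Λ V.σ)) :
    (flip bind (TM2.step M))^[n] (c.map (liftCfg inj)) =
      ((flip bind (TM2.step V.m))^[n] c).map (liftCfg inj) := by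
  have hs : Function.Semiconj (Option.map (liftCfg inj)) (flip bind (TM2.step V.m))
      (flip bind (TM2.step M)) := by
    rintro (_ | ⟨_ | l, v, S⟩)
    · rfl
    · rfl
    · change some (liftCfg inj _) = some (TM2.stepAux (M (inj l)) _ _)
      rw [hM, ← stepAux_liftStmt]
  exact ((hs.iterate_right n) c).symm

variable (e : V.Γ V.k₀ ≃ Option Bool)

/-- The machine that first runs the stack program `p`, writing to the input stack of `V`, and then
runs `V`. -/
def preprocess (p : StackProg) : FinTM2 :=
  letI := p.labelFintype
  letI := V.kDecidableEq
  letI := V.kFin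
  letI := V.ΛFin
  letI := V.σFin
  { K := WorkStack ⊕ V.K
    k₀ := .inl .input
    k₁ := .inr V.k₁
    Γ := CombinedAlphabet V
    Λ := p.Label ⊕ V.Λ
    main := .inl p.entry
    σ := Registers × V.σ
    initialState := (.init, V.initialState)
    Γk₀Fin := inferInstanceAs (Fintype Bool)
    m := Sum.elim (p.code e Sum.inl (.inr V.main)) fun l => liftStmt Sum.inr (V.m l) }

theorem initList_preprocess (p : StackProg) (y : List Bool) :
    initList (preprocess e p) y = (Store.start y).cfg e (.inl p.entry) := by
  have h : (initList (preprocess e p) y).stk = ((Store.start y).cfg e (Sum.inl p.entry :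
      p.Label ⊕ V.Λ)).stk := by
    funext k
    rcases k with k | k
    · cases k <;> rfl
    · change _ = (initList V []).stk k
      by_cases hk : k = V.k₀
      · subst hk
        change [] = _
        simp [initList]
        rfl
      · simp only [initList, hk, dite_false]; rfl
  simp only [initList] at h ⊢
  rw [h]
  rfl

theorem liftCfg_haltList (p : StackProg) (z : List (V.Γ V.k₁)) :
    liftCfg (Λ := p.Label ⊕ V.Λ) Sum.inr (haltList V z) = haltList (preprocess e p) z := by
  have h : (liftCfg (Λ := p.Label ⊕ V.Λ) Sum.inr (haltList V z)).stk =
      (haltList (preprocess e p) z).stk := by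
    funext k
    rcases k with k | k
    · rfl
    · by_cases hk : k = V.k₁
      · subst hk
        simp [liftCfg, combinedStacks, haltList, preprocess]
        rfl
      · simp [liftCfg, combinedStacks, haltList, preprocess, hk]
  simp only [haltList, liftCfg] at h ⊢
  rw [h]
  rfl

theorem Polynomial.monotone_eval_nat (q : Polynomial ℕ) : Monotone fun m => q.eval m := by
  intro a b hab
  simp only [Polynomial.eval_eq_sum, Polynomial.sum]
  gcongr

/-- A polynomial-time function on an encoded type, applied to what a polynomial-time stack program
writes, is a polynomial-time function. -/
theorem nonempty_computable_comp {α β βΓ : Type} {ea : α → List (Option Bool)}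
    {eb : β → List βΓ} {f : α → β} (c : TM2ComputableInPolyTime ea eb f) (g : List Bool → α)
    (p : StackProg) (τ ρ : Polynomial ℕ)
    (hp : ∀ y, Exec p (.start y) (.finish (ea (g y))) (τ.eval y.length))
    (hρ : ∀ y, (ea (g y)).length ≤ ρ.eval y.length) :
    Nonempty (TM2ComputableInPolyTime (fun y : List Bool => y) eb (f ∘ g)) := by
  have key : ∀ y : List Bool, ∃ n ≤ (τ + c.time.comp ρ).eval y.length,
      (flip bind (preprocess c.inputAlphabet p).step)^[n]
        (some (initList (preprocess c.inputAlphabet p) y)) =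
      some (haltList (preprocess c.inputAlphabet p)
        ((eb (f (g y))).map c.outputAlphabet.invFun)) := by
    intro y
    obtain ⟨n, hn, h⟩ := (hp y).reachesIn c.inputAlphabet (preprocess c.inputAlphabet p).m Sum.inl
      (.inr c.tm.main) fun _ => rfl
    obtain ⟨⟨n', h'⟩, hn'⟩ := c.outputsFun (g y)
    refine ⟨n' + n, ?_, ?_⟩
    · have hm : Monotone fun m => c.time.eval m := c.time.monotone_eval_nat
      rw [Polynomial.eval_add, Polynomial.eval_comp]
      have := hm (hρ y)
      simp only at this hn'
      omega
    · rw [Function.iterate_add_apply, initList_preprocess]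
      refine (congrArg _ h).trans ?_
      have hl : (Store.finish (ea (g y))).cfg c.inputAlphabet
          (Sum.inr c.tm.main : p.Label ⊕ c.tm.Λ) =
          liftCfg Sum.inr (initList c.tm ((ea (g y)).map c.inputAlphabet.invFun)) := by
        have : (Store.finish (ea (g y))).get = fun _ => [] := by
          funext k; cases k <;> rfl
        simp only [Store.cfg, liftCfg, this]
        rfl
      refine (congrArg (fun c' => (flip bind _)^[n'] (some c')) hl).trans ?_
      refine (iterate_liftCfg Sum.inr (preprocess c.inputAlphabet p).m (fun _ => rfl) n'
        (some _)).trans ?_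
      refine (congrArg (Option.map _) h').trans ?_
      exact congrArg some (liftCfg_haltList c.inputAlphabet p _)
  choose n hn h using key
  exact ⟨{
    tm := preprocess c.inputAlphabet p
    inputAlphabet := Equiv.refl Bool
    outputAlphabet := c.outputAlphabet
    time := τ + c.time.comp ρ
    outputsFun := fun y => {
      steps := n y
      evals_in_steps := by
        have : y.map (Equiv.refl Bool).invFun = y := List.map_id y
        erw [this]
        exact h y
      steps_le_m := hn y } }⟩

end Preprocess

/-! ### Parsing a padded truth table -/

/-- The bits of a string, taken two at a time; a last unpaired bit is dropped. -/
def bitPairs : List Bool → List (Bool × Bool)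
  | d :: t :: y => (d, t) :: bitPairs y
  | _ => []

/-- The first components of the longest prefix all of whose second components are `true`. -/
def markedPrefix (l : List (Bool × Bool)) : List Bool :=
  (l.takeWhile Prod.snd).map Prod.fst

/-- What follows the marked prefix and the unmarked pair that ends it. -/
def afterMarkedPrefix (l : List (Bool × Bool)) : List (Bool × Bool) :=
  (l.dropWhile Prod.snd).tail

/-- The string `x` in a padded string `x # w # padding`. -/
def tablePart (y : List Bool) : List Bool := markedPrefix (bitPairs y)

/-- The string `w` in a padded string `x # w # padding`. -/
def witnessPart (y : List Bool) : List Bool := markedPrefix (afterMarkedPrefix (bitPairs y))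

/-- The lengths of `y` and of its witness are as prescribed by the length of its table. -/
def IsWellFormed (c : ℕ) (q : Polynomial ℕ) (y : List Bool) : Prop :=
  y.length = 2 * (tablePart y).length ^ c ∧
    (witnessPart y).length ≤ q.eval (tablePart y).length

open Classical in
/-- The table and the witness of a well-formed string, and two empty strings otherwise. -/
noncomputable def parse (c : ℕ) (q : Polynomial ℕ) (y : List Bool) : List Bool × List Bool :=
  if IsWellFormed c q y then (tablePart y, witnessPart y) else ([], [])

@[simp] theorem markedPrefix_nil : markedPrefix [] = [] := rfl

@[simp] theorem afterMarkedPrefix_nil : afterMarkedPrefix [] = [] := rfl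

@[simp] theorem markedPrefix_cons_true (d : Bool) (l : List (Bool × Bool)) :
    markedPrefix ((d, true) :: l) = d :: markedPrefix l := by simp [markedPrefix]

@[simp] theorem markedPrefix_cons_false (d : Bool) (l : List (Bool × Bool)) :
    markedPrefix ((d, false) :: l) = [] := by simp [markedPrefix]

@[simp] theorem afterMarkedPrefix_cons_true (d : Bool) (l : List (Bool × Bool)) :
    afterMarkedPrefix ((d, true) :: l) = afterMarkedPrefix l := by simp [afterMarkedPrefix]

@[simp] theorem afterMarkedPrefix_cons_false (d : Bool) (l : List (Bool × Bool)) :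
    afterMarkedPrefix ((d, false) :: l) = l := by simp [afterMarkedPrefix]

theorem markedPrefix_length_le (l : List (Bool × Bool)) : (markedPrefix l).length ≤ l.length := by
  simpa [markedPrefix] using (l.takeWhile_sublist Prod.snd).length_le

/-- The two parts occupy disjoint segments. -/
theorem length_parts_le (l : List (Bool × Bool)) :
    (markedPrefix l).length + (markedPrefix (afterMarkedPrefix l)).length ≤ l.length := by
  induction l with
  | nil => simp
  | cons a l ih =>
    obtain ⟨d, _ | _⟩ := a
    · simpa using (markedPrefix_length_le l).trans (Nat.le_succ _)
    · simp; omega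

theorem two_add_div_two (n : ℕ) : (n + 1 + 1) / 2 = n / 2 + 1 := by omega

theorem two_add_mod_two (n : ℕ) : (n + 1 + 1) % 2 = n % 2 := by omega

theorem length_bitPairs : ∀ y : List Bool, (bitPairs y).length = y.length / 2
  | [] => rfl
  | [_] => by simp [bitPairs]
  | d :: t :: y => by simp [bitPairs, length_bitPairs y, two_add_div_two]

/-! ### A stack program for parsing -/

theorem Exec.cast {p : StackProg} {s s' s'' : Store} {t t' : ℕ} (h : Exec p s s' t)
    (hs : s' = s'') (ht : t ≤ t') : Exec p s s'' t' :=
  hs ▸ h.mono ht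

/-- The bit in the register `last`. -/
def Registers.lastBit (g : Registers) : Bool := g.last.getD false

namespace StackProg

/-- Do nothing. -/
def skip : StackProg := .load id

/-- Process the pair of bits whose first bit has just been popped. In phase `0` the table is read,
in phase `1` the witness, in phase `2` the padding. -/
def readPair : StackProg :=
  .seq (.load fun g => { g with saved := g.lastBit }) <|
  .seq (.pop .input) <|
  .ite (fun g => g.last.isNone) (.load fun g => { g with bad := true }) <|
  .seq (.push .blocks fun _ => true) <|
  .ite (fun g => g.phase == 0)
    (.ite Registers.lastBit (.push .table Registers.saved) (.load fun g => { g with phase := 1 })) <|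
  .ite (fun g => g.phase == 1)
    (.ite Registers.lastBit
      (.seq (.push .witness Registers.saved) (.push .count fun _ => true))
      (.load fun g => { g with phase := 2 }))
    skip

/-- Multiply the number `acc`, in unary, by the length of the table. -/
def mulTable : StackProg :=
  .seq
    (.loop .acc
      (.seq (.loop .table (.seq (.push .temp Registers.lastBit) (.push .spare fun _ => true)))
        (.loop .temp (.push .table Registers.lastBit))))
    (.loop .spare (.push .acc fun _ => true))

/-- Add the constant `a` to the number `acc`, in unary. -/
def addConst : ℕ → StackProg
  | 0 => skip
  | a + 1 => .seq (.push .acc fun _ => true) (addConst a)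

/-- Subtract the number `k` from the number `acc`, and raise `bad` if `k` is larger. -/
def subtract (k : WorkStack) : StackProg :=
  .loop k (.seq (.pop .acc) (.load fun g => { g with bad := g.last.isNone || g.bad }))

/-- Write the popped bit to the output, unless the input is malformed. -/
def emitLast : StackProg := .ite Registers.bad skip (.emit Registers.last)

/-- The parsing program, given programs that compute the prescribed length of the input and the
bound on the length of the witness. -/
def parser (p p' : StackProg) : StackProg :=
  .seq (.seq (.loop .input readPair) (.load fun g => { g with saved := false, phase := 0 })) <|
  .seq p <| .seq (subtract .blocks) <|
  .seq (.loop .acc (.load fun g => { g with bad := true })) <|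
  .seq p' <| .seq (subtract .count) <|
  .seq (.loop .acc skip) <|
  .seq (.loop .witness emitLast) <| .seq (.emit fun _ => none) <|
  .seq (.loop .table emitLast) (.load fun _ => .init)

end StackProg

open StackProg

/-- The reading loop from phase `2` on: the remaining pairs are only counted, and an unpaired last
bit raises `bad`. -/
theorem exec_read_padding (y : List Bool) (s : Store) (a : Option Bool) (d b : Bool) :
    ∃ d' φ, Exec (.loop .input readPair) { s with input := y, reg := ⟨a, d, 2, b⟩ }
      { s with
        input := []
        reg := ⟨none, d', φ, b || decide (y.length % 2 = 1)⟩
        blocks := List.replicate (y.length / 2) true ++ s.blocks } (10 * y.length + 1) := by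
  match y with
  | [] => exact ⟨d, 2, Exec.cast (Exec.loop_nil rfl) (by simp [Store.pop, Store.set, Store.get])
      (by simp)⟩
  | [x] =>
    refine ⟨x, 2, Exec.cast (Exec.loop_cons (by simp [Store.get]) (.seq (.load _ _) (.seq (.pop _ _)
      (.ite_true rfl (.load _ _)))) (.loop_nil rfl)) ?_ (by simp)⟩
    simp [Store.pop, Store.set, Store.get, Registers.lastBit]
  | x :: t :: y =>
    obtain ⟨d', φ, ih⟩ := exec_read_padding y { s with blocks := true :: s.blocks } (some t) x b
    refine ⟨d', φ, Exec.cast (Exec.loop_cons (by simp [Store.get]) (.seq (.load _ _) (.seq (.pop _ _)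
      (.ite_false rfl (.seq (.push _ _ _) (.ite_false rfl (.ite_false rfl (.load _ _)))))))
        ih) ?_ ?_⟩
    · simp [List.replicate_succ', two_add_div_two, two_add_mod_two]
    · simp only [List.length_cons]; omega

/-- The reading loop from phase `1` on. -/
theorem exec_read_witness (y : List Bool) (s : Store) (a : Option Bool) (d b : Bool) :
    ∃ d' φ, Exec (.loop .input readPair) { s with input := y, reg := ⟨a, d, 1, b⟩ }
      { s with
        input := []
        reg := ⟨none, d', φ, b || decide (y.length % 2 = 1)⟩
        witness := (markedPrefix (bitPairs y)).reverse ++ s.witness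
        count := List.replicate (markedPrefix (bitPairs y)).length true ++ s.count
        blocks := List.replicate (y.length / 2) true ++ s.blocks } (10 * y.length + 1) := by
  match y with
  | [] => exact ⟨d, 1, Exec.cast (Exec.loop_nil rfl)
      (by simp [Store.pop, Store.set, Store.get, bitPairs]) (by simp)⟩
  | [x] =>
    refine ⟨x, 1, Exec.cast (Exec.loop_cons (by simp [Store.get]) (.seq (.load _ _) (.seq (.pop _ _)
      (.ite_true rfl (.load _ _)))) (.loop_nil rfl)) ?_ (by simp)⟩
    simp [Store.pop, Store.set, Store.get, Registers.lastBit, bitPairs]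
  | x :: true :: y =>
    obtain ⟨d', φ, ih⟩ := exec_read_witness y
      { s with blocks := true :: s.blocks, witness := x :: s.witness, count := true :: s.count }
      (some true) x b
    refine ⟨d', φ, Exec.cast (Exec.loop_cons (by simp [Store.get]) (.seq (.load _ _) (.seq (.pop _ _)
      (.ite_false rfl (.seq (.push _ _ _) (.ite_false rfl (.ite_true rfl (.ite_true rfl
        (.seq (.push _ _ _) (.push _ _ _)))))))))
        ih) ?_ ?_⟩
    · simp [List.replicate_succ', two_add_div_two, two_add_mod_two, bitPairs]
    · simp only [List.length_cons]; omega
  | x :: false :: y =>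
    obtain ⟨d', φ, ih⟩ := exec_read_padding y
      { s with blocks := true :: s.blocks } (some false) x b
    refine ⟨d', φ, Exec.cast (Exec.loop_cons (by simp [Store.get]) (.seq (.load _ _) (.seq (.pop _ _)
      (.ite_false rfl (.seq (.push _ _ _) (.ite_false rfl (.ite_true rfl (.ite_false rfl
        (.load _ _))))))))
        ih) ?_ ?_⟩
    · simp [List.replicate_succ', two_add_div_two, two_add_mod_two, bitPairs]
    · simp only [List.length_cons]; omega

/-- The reading loop from phase `0` on. The table and the witness end up in reverse, which the last
two loops of `parser` undo. -/
theorem exec_read_table (y : List Bool) (s : Store) (a : Option Bool) (d b : Bool) :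
    ∃ d' φ, Exec (.loop .input readPair) { s with input := y, reg := ⟨a, d, 0, b⟩ }
      { s with
        input := []
        reg := ⟨none, d', φ, b || decide (y.length % 2 = 1)⟩
        table := (tablePart y).reverse ++ s.table
        witness := (witnessPart y).reverse ++ s.witness
        count := List.replicate (witnessPart y).length true ++ s.count
        blocks := List.replicate (y.length / 2) true ++ s.blocks } (10 * y.length + 1) := by
  match y with
  | [] => exact ⟨d, 0, Exec.cast (Exec.loop_nil rfl)
      (by simp [Store.pop, Store.set, Store.get, bitPairs, tablePart, witnessPart]) (by simp)⟩
  | [x] =>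
    refine ⟨x, 0, Exec.cast (Exec.loop_cons (by simp [Store.get]) (.seq (.load _ _) (.seq (.pop _ _)
      (.ite_true rfl (.load _ _)))) (.loop_nil rfl)) ?_ (by simp)⟩
    simp [Store.pop, Store.set, Store.get, Registers.lastBit, bitPairs, tablePart, witnessPart]
  | x :: true :: y =>
    obtain ⟨d', φ, ih⟩ := exec_read_table y
      { s with blocks := true :: s.blocks, table := x :: s.table } (some true) x b
    refine ⟨d', φ, Exec.cast (Exec.loop_cons (by simp [Store.get]) (.seq (.load _ _) (.seq (.pop _ _)
      (.ite_false rfl (.seq (.push _ _ _) (.ite_true rfl (.ite_true rfl (.push _ _ _)))))))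
        ih) ?_ ?_⟩
    · simp [List.replicate_succ', two_add_div_two, two_add_mod_two, bitPairs, tablePart, witnessPart]
    · simp only [List.length_cons]; omega
  | x :: false :: y =>
    obtain ⟨d', φ, ih⟩ := exec_read_witness y
      { s with blocks := true :: s.blocks } (some false) x b
    refine ⟨d', φ, Exec.cast (Exec.loop_cons (by simp [Store.get]) (.seq (.load _ _) (.seq (.pop _ _)
      (.ite_false rfl (.seq (.push _ _ _) (.ite_true rfl (.ite_false rfl (.load _ _)))))))
        ih) ?_ ?_⟩
    · simp [List.replicate_succ', two_add_div_two, two_add_mod_two, bitPairs, tablePart, witnessPart]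
    · simp only [List.length_cons]; omega

/-- The inner loop of a multiplication: the length of the table is added to `spare`. -/
theorem exec_table_to_temp (l : List Bool) (s : Store) :
    Exec (.loop .table (.seq (.push .temp Registers.lastBit) (.push .spare fun _ => true)))
      { s with table := l }
      { s with
        reg := { s.reg with last := none }
        table := []
        temp := l.reverse ++ s.temp
        spare := List.replicate l.length true ++ s.spare } (3 * l.length + 1) := by
  induction l generalizing s with
  | nil => exact Exec.loop_nil rfl
  | cons x l ih =>
    refine Exec.cast (Exec.loop_cons (by simp [Store.get]) (.seq (.push _ _ _) (.push _ _ _))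
      (ih { s with
        reg := { s.reg with last := some x }
        temp := x :: s.temp
        spare := true :: s.spare })) ?_ ?_
    · simp [List.replicate_succ']
    · simp only [List.length_cons]; omega

/-- The second inner loop of a multiplication: the table is restored. -/
theorem exec_temp_to_table (l : List Bool) (s : Store) :
    Exec (.loop .temp (.push .table Registers.lastBit)) { s with temp := l }
      { s with
        reg := { s.reg with last := none }
        temp := []
        table := l.reverse ++ s.table } (2 * l.length + 1) := by
  induction l generalizing s with
  | nil => exact Exec.loop_nil rfl
  | cons x l ih =>
    refine Exec.cast (Exec.loop_cons (by simp [Store.get]) (.push _ _ _)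
      (ih { s with
        reg := { s.reg with last := some x }
        table := x :: s.table })) ?_ ?_
    · simp
    · simp only [List.length_cons]; omega

theorem exec_spare_to_acc (m n : ℕ) (s : Store) :
    Exec (.loop .spare (.push .acc fun _ => true))
      { s with spare := List.replicate m true, acc := List.replicate n true }
      { s with
        reg := { s.reg with last := none }
        spare := []
        acc := List.replicate (m + n) true } (2 * m + 1) := by
  induction m generalizing s n with
  | zero => exact Exec.cast (Exec.loop_nil rfl) (by simp [Store.pop, Store.set, Store.get]) (by simp)
  | succ m ih =>
    refine Exec.cast (Exec.loop_cons (by simp [Store.get, List.replicate_succ]) (.push _ _ _)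
      (ih (n + 1) { s with reg := { s.reg with last := some true } })) ?_ ?_
    · simp; omega
    · omega

theorem exec_acc_to_spare (m n : ℕ) (s : Store) :
    Exec (.loop .acc
      (.seq (.loop .table (.seq (.push .temp Registers.lastBit) (.push .spare fun _ => true)))
        (.loop .temp (.push .table Registers.lastBit))))
      { s with acc := List.replicate m true, spare := List.replicate n true, temp := [] }
      { s with
        reg := { s.reg with last := none }
        acc := []
        temp := []
        spare := List.replicate (m * s.table.length + n) true }
      (m * (5 * s.table.length + 3) + 1) := by
  induction m generalizing s n with
  | zero => exact Exec.cast (Exec.loop_nil rfl) (by simp [Store.pop, Store.set, Store.get]) (by simp)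
  | succ m ih =>
    have h₁ := exec_table_to_temp s.table { s with
      reg := { s.reg with last := some true }
      acc := List.replicate m true
      spare := List.replicate n true
      temp := [] }
    have h₂ := exec_temp_to_table (s.table.reverse ++ []) { s with
      reg := { s.reg with last := none }
      acc := List.replicate m true
      table := []
      spare := List.replicate s.table.length true ++ List.replicate n true }
    have h₃ := ih (s.table.length + n) { s with reg := { s.reg with last := none } }
    refine Exec.cast (Exec.loop_cons (by simp [Store.get, List.replicate_succ])
      ((h₁.seq h₂).cast ?_ le_rfl) h₃) ?_ ?_
    · simp
    · simp; ring
    · simp; ring_nf; omega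

theorem exec_mulTable (m : ℕ) (s : Store) :
    Exec mulTable { s with acc := List.replicate m true, spare := [], temp := [] }
      { s with
        reg := { s.reg with last := none }
        acc := List.replicate (m * s.table.length) true
        spare := []
        temp := [] }
      (10 * (m + 1) * (s.table.length + 1)) := by
  refine Exec.cast (Exec.seq (exec_acc_to_spare m 0 s) (exec_spare_to_acc (m * s.table.length) 0
    { s with
      reg := { s.reg with last := none }
      acc := []
      temp := [] })) rfl ?_
  nlinarith

theorem exec_addConst (a m : ℕ) (s : Store) :
    Exec (addConst a) { s with acc := List.replicate m true }
      { s with acc := List.replicate (m + a) true } (a + 1) := by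
  induction a generalizing m with
  | zero => exact Exec.load _ _
  | succ a ih =>
    refine Exec.cast (Exec.seq (.push _ _ _) (ih (m + 1))) ?_ ?_
    · simp; omega
    · omega

/-- Every polynomial in the length of the table can be evaluated in unary, in polynomial time, by
Horner's rule. -/
theorem exists_exec_eval (q : Polynomial ℕ) :
    ∃ (p : StackProg) (τ : Polynomial ℕ), ∀ s : Store,
      Exec p { s with acc := [], spare := [], temp := [] }
        { s with
          reg := { s.reg with last := none }
          acc := List.replicate (q.eval s.table.length) true
          spare := []
          temp := [] } (τ.eval s.table.length) := by
  induction q using Polynomial.recOnHorner with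
  | M0 =>
    exact ⟨.load fun g => { g with last := none }, 1, fun s =>
      Exec.cast (Exec.load _ _) (by simp) (by simp)⟩
  | MC q a _ _ ih =>
    obtain ⟨p, τ, h⟩ := ih
    refine ⟨.seq p (addConst a), τ + .C (a + 1), fun s => Exec.cast ((h s).seq (exec_addConst a _ { s with
      reg := { s.reg with last := none }
      spare := []
      temp := [] })) (by simp) (by simp)⟩
  | MX q _ ih =>
    obtain ⟨p, τ, h⟩ := ih
    refine ⟨.seq p mulTable, τ + 10 * (q + 1) * (.X + 1), fun s =>
      Exec.cast ((h s).seq (exec_mulTable _ { s with reg := { s.reg with last := none } }))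
        (by simp) (by simp)⟩

theorem exec_subtract {k : WorkStack} (hk : k ≠ .acc) (m n : ℕ) (s : Store) (b : Bool)
    (hb : b = (decide (n < m) || s.reg.bad)) :
    Exec (subtract k) ({ s with acc := List.replicate n true }.set k (List.replicate m true))
      ({ s with
          reg := { s.reg with last := none, bad := b }
          acc := List.replicate (n - m) true }.set k []) (3 * m + 1) := by
  induction m generalizing n s with
  | zero =>
    subst hb
    cases k <;> first
      | exact absurd rfl hk
      | exact Exec.cast (Exec.loop_nil rfl) (by simp [Store.pop, Store.set, Store.get]) (by simp)
  | succ m ih =>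
    have h := ih (n - 1)
      { s with reg := { s.reg with last := (List.replicate n true).head?, bad := n == 0 || s.reg.bad } }
      (by subst hb; cases n <;> simp)
    have hn : n - (m + 1) = n - 1 - m := by omega
    cases n <;> cases k <;> first
      | exact absurd rfl hk
      | exact Exec.cast (Exec.loop_cons (by simp [Store.set, Store.get, List.replicate_succ])
          (.seq (.pop _ _) (.load _ _)) h) (by simp [hn]) (by omega)

/-- What is left of `acc` after a subtraction is removed, and raises `bad` if it is not zero. -/
theorem exec_clear_acc_bad (m : ℕ) (s : Store) (b : Bool)
    (hb : b = (decide (0 < m) || s.reg.bad)) :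
    Exec (.loop .acc (.load fun g => { g with bad := true }))
      { s with acc := List.replicate m true }
      { s with reg := { s.reg with last := none, bad := b }, acc := [] } (2 * m + 1) := by
  induction m generalizing s with
  | zero =>
    subst hb
    exact Exec.cast (Exec.loop_nil rfl) (by simp [Store.pop, Store.set, Store.get]) (by simp)
  | succ m ih =>
    refine Exec.cast (Exec.loop_cons (by simp [Store.get, List.replicate_succ]) (.load _ _)
      (ih { s with reg := { s.reg with last := some true, bad := true } } ?_)) rfl (by omega)
    simp [hb]

theorem exec_clear_acc (m : ℕ) (s : Store) :
    Exec (.loop .acc skip) { s with acc := List.replicate m true }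
      { s with reg := { s.reg with last := none }, acc := [] } (2 * m + 1) := by
  induction m generalizing s with
  | zero => exact Exec.cast (Exec.loop_nil rfl) (by simp [Store.pop, Store.set, Store.get]) (by simp)
  | succ m ih =>
    exact Exec.cast (Exec.loop_cons (by simp [Store.get, List.replicate_succ]) (.load _ _)
      (ih { s with reg := { s.reg with last := some true } })) rfl (by omega)

theorem exec_emit_witness (l : List Bool) (s : Store) :
    Exec (.loop .witness emitLast) { s with witness := l }
      { s with
        reg := { s.reg with last := none }
        witness := []
        out := (if s.reg.bad then [] else l.reverse.map some) ++ s.out } (3 * l.length + 1) := by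
  induction l generalizing s with
  | nil => exact Exec.cast (Exec.loop_nil rfl) (by simp [Store.pop, Store.set, Store.get]) (by simp)
  | cons x l ih =>
    cases hb : s.reg.bad
    · refine Exec.cast (Exec.loop_cons (by simp [Store.get]) (.ite_false hb (.emit _ _))
        (ih { s with reg := { s.reg with last := some x }, out := some x :: s.out })) ?_ ?_
      · simp [hb]
      · simp only [List.length_cons]; omega
    · refine Exec.cast (Exec.loop_cons (by simp [Store.get]) (.ite_true hb (.load _ _))
        (ih { s with reg := { s.reg with last := some x } })) ?_ ?_
      · simp [hb]
      · simp only [List.length_cons]; omega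

theorem exec_emit_table (l : List Bool) (s : Store) :
    Exec (.loop .table emitLast) { s with table := l }
      { s with
        reg := { s.reg with last := none }
        table := []
        out := (if s.reg.bad then [] else l.reverse.map some) ++ s.out } (3 * l.length + 1) := by
  induction l generalizing s with
  | nil => exact Exec.cast (Exec.loop_nil rfl) (by simp [Store.pop, Store.set, Store.get]) (by simp)
  | cons x l ih =>
    cases hb : s.reg.bad
    · refine Exec.cast (Exec.loop_cons (by simp [Store.get]) (.ite_false hb (.emit _ _))
        (ih { s with reg := { s.reg with last := some x }, out := some x :: s.out })) ?_ ?_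
      · simp [hb]
      · simp only [List.length_cons]; omega
    · refine Exec.cast (Exec.loop_cons (by simp [Store.get]) (.ite_true hb (.load _ _))
        (ih { s with reg := { s.reg with last := some x } })) ?_ ?_
      · simp [hb]
      · simp only [List.length_cons]; omega

theorem length_tablePart_add_length_witnessPart_le (y : List Bool) :
    (tablePart y).length + (witnessPart y).length ≤ y.length / 2 :=
  (length_parts_le _).trans_eq (length_bitPairs y)

theorem length_encodePair_parse_le (c : ℕ) (q : Polynomial ℕ) (y : List Bool) :
    (encodePair (parse c q y)).length ≤ y.length + 1 := by
  have := length_tablePart_add_length_witnessPart_le y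
  unfold parse
  split_ifs <;> simp [encodePair]
  omega

/-- Parsing takes polynomial time. -/
theorem exists_exec_parse (c : ℕ) (q : Polynomial ℕ) :
    ∃ (p : StackProg) (τ : Polynomial ℕ), ∀ y : List Bool,
      Exec p (.start y) (.finish (encodePair (parse c q y))) (τ.eval y.length) := by
  obtain ⟨p₁, τ₁, h₁⟩ := exists_exec_eval (.X ^ c)
  obtain ⟨p₂, τ₂, h₂⟩ := exists_exec_eval q
  refine ⟨parser p₁ p₂, 30 * .X + 20 + τ₁ + 2 * .X ^ c + τ₂ + 2 * q, fun y => ?_⟩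
  have hle := length_tablePart_add_length_witnessPart_le y
  obtain ⟨d, φ, e₁⟩ := exec_read_table y (.start y) none false false
  set x := tablePart y with hx
  set w := witnessPart y with hw
  set b₀ := decide (y.length % 2 = 1) with hb₀
  set b₁ := (decide (x.length ^ c < y.length / 2) || b₀) with hb₁
  set b₂ := (decide (0 < x.length ^ c - y.length / 2) || b₁) with hb₂
  set b₃ := (decide (q.eval x.length < w.length) || b₂) with hb₃
  -- the memory after reading, as a function of what still changes from then on
  let S : Bool → List Bool → List Bool → List Bool → List Bool → List (Option Bool) → Store :=
    fun b wt bl ct a o => ⟨⟨none, false, 0, b⟩, [], x.reverse, wt, bl, ct, a, [], [], o⟩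
  let R : ℕ → List Bool := fun n => .replicate n true
  have f₁ : Exec (.seq (.loop .input readPair)
      (.load fun g => { g with saved := false, phase := 0 })) (.start y)
      (S b₀ w.reverse (R (y.length / 2)) (R w.length) [] []) (10 * y.length + 1 + 1) :=
    Exec.cast (e₁.seq (.load _ _)) (by simp [S, R, Store.start]) le_rfl
  have f₂ : Exec p₁ (S b₀ w.reverse (R (y.length / 2)) (R w.length) [] [])
      (S b₀ w.reverse (R (y.length / 2)) (R w.length) (R (x.length ^ c)) [])
      (τ₁.eval x.length) :=
    Exec.cast (h₁ (S b₀ w.reverse (R (y.length / 2)) (R w.length) [] []))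
      (by simp [S, R]) (by simp [S])
  have f₃ : Exec (subtract .blocks)
      (S b₀ w.reverse (R (y.length / 2)) (R w.length) (R (x.length ^ c)) [])
      (S b₁ w.reverse [] (R w.length) (R (x.length ^ c - y.length / 2)) [])
      (3 * (y.length / 2) + 1) :=
    exec_subtract (k := .blocks) (by simp) (y.length / 2) (x.length ^ c)
      (S b₀ w.reverse [] (R w.length) [] []) b₁ rfl
  have f₄ : Exec (.loop .acc (.load fun g => { g with bad := true }))
      (S b₁ w.reverse [] (R w.length) (R (x.length ^ c - y.length / 2)) [])
      (S b₂ w.reverse [] (R w.length) [] []) (2 * (x.length ^ c - y.length / 2) + 1) :=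
    exec_clear_acc_bad _ (S b₁ w.reverse [] (R w.length) [] []) b₂ rfl
  have f₅ : Exec p₂ (S b₂ w.reverse [] (R w.length) [] [])
      (S b₂ w.reverse [] (R w.length) (R (q.eval x.length)) []) (τ₂.eval x.length) :=
    Exec.cast (h₂ (S b₂ w.reverse [] (R w.length) [] [])) (by simp [S, R]) (by simp [S])
  have f₆ : Exec (subtract .count) (S b₂ w.reverse [] (R w.length) (R (q.eval x.length)) [])
      (S b₃ w.reverse [] [] (R (q.eval x.length - w.length)) []) (3 * w.length + 1) :=
    exec_subtract (k := .count) (by simp) w.length (q.eval x.length)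
      (S b₂ w.reverse [] [] [] []) b₃ rfl
  have f₇ : Exec (.loop .acc skip) (S b₃ w.reverse [] [] (R (q.eval x.length - w.length)) [])
      (S b₃ w.reverse [] [] [] []) (2 * (q.eval x.length - w.length) + 1) :=
    exec_clear_acc _ (S b₃ w.reverse [] [] [] [])
  have f₈ : Exec (.loop .witness emitLast) (S b₃ w.reverse [] [] [] [])
      (S b₃ [] [] [] [] (if b₃ then [] else w.map some)) (3 * w.length + 1) :=
    Exec.cast (exec_emit_witness w.reverse (S b₃ [] [] [] [] [])) (by simp [S]) (by simp)
  have f₉ : Exec (.seq (.loop .table emitLast) (.load fun _ => .init))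
      (S b₃ [] [] [] [] (none :: if b₃ then [] else w.map some))
      (.finish ((if b₃ then [] else x.map some) ++ none :: if b₃ then [] else w.map some))
      (3 * x.length + 1 + 1) :=
    Exec.cast ((exec_emit_table x.reverse (S b₃ [] [] [] []
      (none :: if b₃ then [] else w.map some))).seq (.load _ _)) (by simp [S, Store.finish])
      (by simp)
  -- `y` has even length, and half of it is neither more nor less than `|x| ^ c`
  have hb : b₃ = true ↔ ¬ IsWellFormed c q y := by
    simp only [IsWellFormed, ← hx, ← hw, hb₀, hb₁, hb₂, hb₃, Bool.or_eq_true, decide_eq_true_eq]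
    omega
  have hout : (if b₃ then [] else x.map some) ++ none :: (if b₃ then [] else w.map some) =
      encodePair (parse c q y) := by
    by_cases h : IsWellFormed c q y
    · rw [parse, if_pos h, if_neg (by simpa using fun h' => hb.1 h' h),
        if_neg (by simpa using fun h' => hb.1 h' h)]
      rfl
    · rw [parse, if_neg h, if_pos (hb.2 h), if_pos (hb.2 h)]
      rfl
  refine Exec.cast (f₁.seq <| f₂.seq <| f₃.seq <| f₄.seq <| f₅.seq <| f₆.seq <| f₇.seq <|
    f₈.seq <| Exec.seq (.emit (fun _ => none) _) f₉) (by rw [hout]) ?_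
  have m₁ := τ₁.monotone_eval_nat (show x.length ≤ y.length by omega)
  have m₂ := τ₂.monotone_eval_nat (show x.length ≤ y.length by omega)
  have m₃ := q.monotone_eval_nat (show x.length ≤ y.length by omega)
  have m₄ : x.length ^ c ≤ y.length ^ c := by gcongr; omega
  simp at m₁ m₂ m₃ ⊢
  omega

/-! ### Restrictions of circuits -/

/-- The source obtained by fixing some variables and renaming the others: the variable `j` becomes
the constant `b` if `ρ j = inl b` and the variable `i` if `ρ j = inr i`. -/
def Source.restrict {m n s : ℕ} (ρ : Fin m → Bool ⊕ Fin n) : Source m s → Source n s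
  | .const b => .const b
  | .var j => (ρ j).elim (fun b => .const b) .var
  | .negVar j => (ρ j).elim (fun b => .const !b) .negVar
  | .gate j => .gate j

/-- The circuit obtained by fixing some variables and renaming the others. -/
def Circuit.restrict {m n : ℕ} (ρ : Fin m → Bool ⊕ Fin n) : {s : ℕ} → Circuit m s → Circuit n s
  | _, .nil => .nil
  | _, .snoc c g src => .snoc (c.restrict ρ) g fun a => (src a).restrict ρ

/-- The assignment to all variables given by one to the variables that are not fixed. -/
def extendAssignment {m n : ℕ} (ρ : Fin m → Bool ⊕ Fin n) (x : Fin n → Bool) (j : Fin m) : Bool :=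
  (ρ j).elim id x

theorem Source.value_restrict {m n s : ℕ} (ρ : Fin m → Bool ⊕ Fin n) (x : Fin n → Bool)
    (v : Fin s → Bool) (src : Source m s) :
    (src.restrict ρ).value x v = src.value (extendAssignment ρ x) v := by
  cases src with
  | var j | negVar j =>
    rcases h : ρ j with _ | _ <;> simp [Source.restrict, Source.value, extendAssignment, h]
  | _ => rfl

theorem Source.depth_restrict {m n s : ℕ} (ρ : Fin m → Bool ⊕ Fin n) (d : Fin s → ℕ)
    (src : Source m s) : (src.restrict ρ).depth d = src.depth d := by
  cases src with
  | var j | negVar j => rcases h : ρ j with _ | _ <;> simp [Source.restrict, Source.depth, h]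
  | _ => rfl

theorem Circuit.values_restrict {m n s : ℕ} (ρ : Fin m → Bool ⊕ Fin n) (x : Fin n → Bool)
    (c : Circuit m s) : (c.restrict ρ).values x = c.values (extendAssignment ρ x) := by
  induction c with
  | nil => rfl
  | snoc c g src ih => simp only [Circuit.restrict, Circuit.values, ih, Source.value_restrict]

theorem Circuit.depths_restrict {m n s : ℕ} (ρ : Fin m → Bool ⊕ Fin n) (c : Circuit m s) :
    (c.restrict ρ).depths = c.depths := by
  induction c with
  | nil => rfl
  | snoc c g src ih => simp only [Circuit.restrict, Circuit.depths, ih, Source.depth_restrict]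

theorem Circuit.Over.restrict {m n s : ℕ} (ρ : Fin m → Bool ⊕ Fin n) {B : Set Gate}
    {c : Circuit m s} (h : c.Over B) : (c.restrict ρ).Over B := by
  induction c with
  | nil => trivial
  | snoc c g src ih => exact ⟨ih h.1, h.2⟩

theorem HasCircuit.restrict {B : Set Gate} {d : ℕ∞} {s m n : ℕ} {g : (Fin m → Bool) → Bool}
    (h : HasCircuit B d s g) (ρ : Fin m → Bool ⊕ Fin n) :
    HasCircuit B d s fun x => g (extendAssignment ρ x) := by
  obtain ⟨s', hs, c, out, hB, hd, hv⟩ := h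
  refine ⟨s', hs, c.restrict ρ, out.restrict ρ, hB.restrict ρ, ?_, fun x => ?_⟩
  · rwa [Circuit.depths_restrict, Source.depth_restrict]
  · rw [Circuit.values_restrict, Source.value_restrict, hv]

theorem HasCircuit.mono {B : Set Gate} {d d' : ℕ∞} {s s' n : ℕ} {f : (Fin n → Bool) → Bool}
    (h : HasCircuit B d s f) (hd : d ≤ d') (hs : s ≤ s') : HasCircuit B d' s' f := by
  obtain ⟨t, ht, c, out, hB, hc, hv⟩ := h
  exact ⟨t, ht.trans hs, c, out, hB, hc.trans hd, hv⟩

/-! ### Truth tables -/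

/-- The `i`-th assignment to `n` variables in lexicographic order. -/
def assignment (n : ℕ) (i : Fin (2 ^ n)) (j : Fin n) : Bool := (i : ℕ).testBit (Fin.rev j)

theorem assignment_bijective (n : ℕ) : Function.Bijective (assignment n) := by
  refine (Fintype.bijective_iff_injective_and_card _).2 ⟨fun i i' h => ?_, by simp⟩
  refine Fin.ext (Nat.eq_of_testBit_eq fun b => ?_)
  by_cases hb : b < n
  · simpa [assignment] using congrFun h (Fin.rev ⟨b, hb⟩)
  · have hn : 2 ^ n ≤ 2 ^ b := Nat.pow_le_pow_right (by norm_num) (not_lt.1 hb)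
    rw [Nat.testBit_lt_two_pow (i.2.trans_le hn), Nat.testBit_lt_two_pow (i'.2.trans_le hn)]

@[simp] theorem length_truthTable {n : ℕ} (f : (Fin n → Bool) → Bool) :
    (truthTable f).length = 2 ^ n := by
  simp [truthTable]

theorem getElem?_truthTable {n : ℕ} (f : (Fin n → Bool) → Bool) (i : Fin (2 ^ n)) :
    (truthTable f)[(i : ℕ)]? = some (f (assignment n i)) := by
  rw [List.getElem?_eq_getElem (by simp)]
  simp [truthTable]
  rfl

theorem exists_truthTable_eq {n : ℕ} (y : List Bool) (hy : y.length = 2 ^ n) :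
    ∃ f : (Fin n → Bool) → Bool, truthTable f = y := by
  let E := Equiv.ofBijective _ (assignment_bijective n)
  refine ⟨fun z => y[E.symm z], ?_⟩
  refine List.ext_getElem (by simp [hy]) fun i h h' => ?_
  have := getElem?_truthTable (fun z => y[E.symm z]) ⟨i, by simpa using h⟩
  rw [List.getElem?_eq_getElem h] at this
  rw [Option.some.inj this]
  have hE : E.symm (assignment n ⟨i, by simpa using h⟩) = ⟨i, by simpa using h⟩ :=
    E.symm_apply_apply _
  simp [hE]

/-- The marked bits of `y` are found at the even positions of `y`. -/
theorem getElem?_of_markedPrefix : ∀ (y : List Bool) (i : ℕ) (a : Bool),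
    (markedPrefix (bitPairs y))[i]? = some a → y[2 * i]? = some a
  | [], i, a => by simp [bitPairs]
  | [_], i, a => by simp [bitPairs]
  | d :: false :: y, i, a => by simp [bitPairs]
  | d :: true :: y, 0, a => by simp [bitPairs]
  | d :: true :: y, i + 1, a => by
      simpa [bitPairs, mul_add] using getElem?_of_markedPrefix y i a

/-- The restriction of `m` variables to `n`, in which the last variable and all but the `n`
variables before it are fixed to `0`. -/
def tableRestriction (m n : ℕ) (j : Fin m) : Bool ⊕ Fin n :=
  if h : 1 ≤ (Fin.rev j : ℕ) ∧ (Fin.rev j : ℕ) ≤ n then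
    .inr (Fin.rev ⟨(Fin.rev j : ℕ) - 1, by omega⟩)
  else .inl false

theorem extendAssignment_tableRestriction {m n : ℕ} (i : Fin (2 ^ n)) (h : 2 * (i : ℕ) < 2 ^ m) :
    extendAssignment (tableRestriction m n) (assignment n i) = assignment m ⟨2 * i, h⟩ := by
  funext j
  simp only [extendAssignment, tableRestriction, assignment]
  split_ifs with hj
  · obtain ⟨b, hb⟩ := Nat.exists_eq_add_of_le' hj.1
    change (i : ℕ).testBit (Fin.rev (Fin.rev (⟨(Fin.rev j : ℕ) - 1, by omega⟩ : Fin n))) = _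
    rw [Fin.rev_rev]
    simp only [hb]
    rw [Nat.testBit_succ, Nat.mul_div_cancel_left _ (by norm_num), Nat.add_sub_cancel]
  · rcases hb : (Fin.rev j : ℕ) with _ | b
    · simp
    · have hn : 2 ^ n ≤ 2 ^ b := Nat.pow_le_pow_right (by norm_num) (by omega)
      rw [Nat.testBit_succ, Nat.mul_div_cancel_left _ (by norm_num),
        Nat.testBit_lt_two_pow (i.2.trans_le hn)]
      rfl

/-- The table in the truth table of `g` is that of a restriction of `g`. -/
theorem eq_of_tablePart_eq {m n : ℕ} {g : (Fin m → Bool) → Bool} {f : (Fin n → Bool) → Bool}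
    (h : tablePart (truthTable g) = truthTable f) :
    f = fun z => g (extendAssignment (tableRestriction m n) z) := by
  funext z
  obtain ⟨i, rfl⟩ := (assignment_bijective n).2 z
  have h₁ := getElem?_of_markedPrefix (truthTable g) i (f (assignment n i))
    (by rw [← tablePart, h, getElem?_truthTable])
  obtain ⟨hi, -⟩ := List.getElem?_eq_some_iff.1 h₁
  rw [length_truthTable] at hi
  rw [extendAssignment_tableRestriction i hi]
  have h₂ := getElem?_truthTable g ⟨2 * i, hi⟩
  exact Option.some.inj (h₁.symm.trans h₂)

/-! ### Padding a truth table -/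

/-- The string whose bits, taken two at a time, are the given pairs. -/
def flattenPairs : List (Bool × Bool) → List Bool
  | [] => []
  | (d, t) :: l => d :: t :: flattenPairs l

@[simp] theorem bitPairs_flattenPairs (l : List (Bool × Bool)) : bitPairs (flattenPairs l) = l := by
  induction l with
  | nil => rfl
  | cons a l ih => simp [flattenPairs, bitPairs, ih]

@[simp] theorem length_flattenPairs (l : List (Bool × Bool)) :
    (flattenPairs l).length = 2 * l.length := by
  induction l with
  | nil => rfl
  | cons a l ih => simp [flattenPairs, ih]; omega

theorem markedPrefix_append (x : List Bool) (d : Bool) (l : List (Bool × Bool)) :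
    markedPrefix (x.map (·, true) ++ (d, false) :: l) = x := by
  induction x with
  | nil => simp
  | cons a x ih => simpa using ih

theorem afterMarkedPrefix_append (x : List Bool) (d : Bool) (l : List (Bool × Bool)) :
    afterMarkedPrefix (x.map (·, true) ++ (d, false) :: l) = l := by
  induction x with
  | nil => simp
  | cons a x ih => simpa using ih

theorem markedPrefix_append_replicate (w : List Bool) (k : ℕ) :
    markedPrefix (w.map (·, true) ++ List.replicate k (false, false)) = w := by
  cases k with
  | zero => induction w with
    | nil => rfl
    | cons a w ih => simpa using ih
  | succ k => exact markedPrefix_append w false _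

/-- Every table and every witness can be padded to any length that leaves room for both. -/
theorem exists_padding (x w : List Bool) (L : ℕ) (hL : x.length + 1 + w.length ≤ L) :
    ∃ y : List Bool, y.length = 2 * L ∧ tablePart y = x ∧ witnessPart y = w := by
  refine ⟨flattenPairs (x.map (·, true) ++ (false, false) :: (w.map (·, true) ++
    List.replicate (L - (x.length + 1 + w.length)) (false, false))), ?_, ?_, ?_⟩
  · simp; omega
  · rw [tablePart, bitPairs_flattenPairs, markedPrefix_append]
  · rw [witnessPart, bitPairs_flattenPairs, afterMarkedPrefix_append,
      markedPrefix_append_replicate]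

/-! ### Growth of the number of variables -/

/-- Every polynomial is bounded by a pure power, without a constant factor, from `2` on. -/
theorem exists_eval_le_pow (r : Polynomial ℕ) : ∃ c : ℕ, ∀ N, 2 ≤ N → r.eval N ≤ N ^ c := by
  induction r using Polynomial.induction_on' with
  | add r r' ih ih' =>
    obtain ⟨c, hc⟩ := ih
    obtain ⟨c', hc'⟩ := ih'
    refine ⟨max c c' + 1, fun N hN => ?_⟩
    have h₁ : N ^ c ≤ N ^ max c c' := Nat.pow_le_pow_right (by omega) (le_max_left _ _)
    have h₂ : N ^ c' ≤ N ^ max c c' := Nat.pow_le_pow_right (by omega) (le_max_right _ _)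
    rw [Polynomial.eval_add, pow_succ]
    nlinarith [hc N hN, hc' N hN]
  | monomial d a =>
    refine ⟨a + d, fun N hN => ?_⟩
    rw [Polynomial.eval_monomial, pow_add]
    gcongr
    exact Nat.lt_two_pow_self.le.trans (Nat.pow_le_pow_left hN a)

theorem mul_add_one_le_pow (c : ℕ) {n : ℕ} (hn : 2 ≤ n) : c * n + 1 ≤ n ^ (c + 1) := by
  have h : c + 1 ≤ n ^ c := Nat.lt_two_pow_self.trans_le (Nat.pow_le_pow_left hn c)
  rw [pow_succ]
  nlinarith

/-- A linear change of the number of variables stays within a depth regime. -/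
theorem DepthRegime.exists_bound (R : DepthRegime) {D : ℕ → ℕ∞} (hD : D ∈ R.bounds) (c : ℕ) :
    ∃ D' ∈ R.bounds, ∀ n, 2 ≤ n → D (c * n + 1) ≤ D' n := by
  cases R with
  | fixed d =>
    rw [DepthRegime.bounds, Set.mem_singleton_iff] at hD
    subst hD
    exact ⟨_, rfl, fun _ _ => le_rfl⟩
  | unbounded => exact ⟨_, rfl, fun _ _ => le_top⟩
  | bigOLogPow i =>
    obtain ⟨a, rfl⟩ := hD
    refine ⟨_, ⟨a * (c + 1) ^ i, rfl⟩, fun n hn => ?_⟩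
    have hlog : Nat.log 2 (c * n + 1) + 1 ≤ (c + 1) * (Nat.log 2 n + 1) := by
      refine Nat.log_lt_of_lt_pow (by omega) ((mul_add_one_le_pow c hn).trans_lt ?_)
      rw [mul_comm, pow_mul]
      exact Nat.pow_lt_pow_left (Nat.lt_pow_succ_log_self (by norm_num) n) (by omega)
    rw [Nat.cast_le, mul_assoc, ← mul_pow]
    gcongr

/-! ### From `NP` to `P` -/

theorem theorem2 (C : CircuitClass)
    (h : ∃ P : BooleanProperty, P.IsNPProperty ∧ P.UsefulAgainstPoly C) :
    ∃ Q : BooleanProperty, Q.IsPProperty ∧ Q.UsefulAgainstPoly C := by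
  obtain ⟨P, ⟨V, q, ⟨comp⟩, hV⟩, hP⟩ := h
  obtain ⟨c, hc⟩ := exists_eval_le_pow (.X + 1 + q)
  have hc₁ : 1 ≤ c := by
    have := hc 2 le_rfl
    by_contra h0
    obtain rfl : c = 0 := by omega
    simp at this
    omega
  -- what acceptance means: the table belongs to `P`, and its length determines that of the input
  have accept : ∀ y, V (parse c q y) = true → IsWellFormed c q y ∧
      ∃ (n : ℕ) (f : (Fin n → Bool) → Bool), f ∈ P n ∧ tablePart y = truthTable f := by
    intro y hy
    by_cases hw : IsWellFormed c q y
    · rw [parse, if_pos hw] at hy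
      exact ⟨hw, (hV _).2 ⟨_, hw.2, hy⟩⟩
    · -- `V` rejects the empty table, since truth tables are nonempty
      rw [parse, if_neg hw] at hy
      obtain ⟨n, f, -, hf⟩ := (hV []).2 ⟨[], by simp, hy⟩
      have := congrArg List.length hf
      rw [length_truthTable] at this
      exact absurd this (Nat.two_pow_pos n).ne
  have size : ∀ {y n} {f : (Fin n → Bool) → Bool}, IsWellFormed c q y →
      tablePart y = truthTable f → y.length = 2 ^ (c * n + 1) := by
    intro y n f hw ht
    rw [hw.1, ht, length_truthTable, ← pow_mul, pow_succ', mul_comm c]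
  refine ⟨fun n => {g | V (parse c q (truthTable g)) = true}, ⟨V ∘ parse c q, ?_, fun y => ?_⟩, ?_⟩
  · obtain ⟨p, τ, hp⟩ := exists_exec_parse c q
    exact nonempty_computable_comp comp (parse c q) p τ (.X + 1) hp fun y => by
      simpa using length_encodePair_parse_le c q y
  · constructor
    · rintro ⟨n, g, hg, rfl⟩
      exact hg
    · intro hy
      obtain ⟨hw, n, f, -, hf⟩ := accept y hy
      obtain ⟨g, hg⟩ := exists_truthTable_eq y (size hw hf)
      exact ⟨_, g, by rwa [Set.mem_ofPred_eq, hg], hg.symm⟩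
  · intro B hB D hD k
    obtain ⟨D', hD', hDD'⟩ := C.regime.exists_bound hD c
    -- `n = 1` is left out, as no power of `1` bounds `c * 1 + 1`
    have hinf := (hP B hB D' hD' ((c + 1) * k)).sdiff (Set.finite_le_nat 1)
    have hinj : Function.Injective fun n => c * n + 1 := fun a b hab =>
      Nat.eq_of_mul_eq_mul_left hc₁ (Nat.succ.inj hab)
    refine (hinf.image hinj.injOn).mono ?_
    rintro _ ⟨n, ⟨⟨hn, ⟨f, hf⟩, hhard⟩, hn1⟩, rfl⟩
    have hn2 : 2 ≤ n := by simpa [Nat.lt_iff_add_one_le] using hn1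
    refine ⟨Nat.succ_pos _, ?_, fun g hg hgQ => ?_⟩
    · -- a function of `P` in `n` variables, padded together with a witness
      obtain ⟨w, hwlen, hw⟩ := (hV (truthTable f)).1 ⟨n, f, hf, rfl⟩
      have hN : 2 ≤ 2 ^ n := Nat.le_self_pow (by omega) 2
      have hroom := hc (2 ^ n) hN
      rw [length_truthTable] at hwlen
      simp only [Polynomial.eval_add, Polynomial.eval_X, Polynomial.eval_one] at hroom
      obtain ⟨y, hy, hyt, hyw⟩ := exists_padding (truthTable f) w ((2 ^ n) ^ c)
        (by rw [length_truthTable]; omega)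
      have hwf : IsWellFormed c q y := by
        constructor
        · rw [hy, hyt, length_truthTable]
        · rwa [hyt, hyw, length_truthTable]
      obtain ⟨g, hg⟩ := exists_truthTable_eq y (size hwf hyt)
      refine ⟨g, ?_⟩
      rw [Set.mem_ofPred_eq, hg, parse, if_pos hwf, hyt, hyw]
      exact hw
    · -- an easy `g` with the property would have an easy restriction in `P`
      obtain ⟨hwf, n', f', hf', htab⟩ := accept _ hgQ
      have hlen := size hwf htab
      rw [length_truthTable] at hlen
      obtain rfl : n = n' := hinj (Nat.pow_right_injective le_rfl hlen)
      refine hhard f' ?_ hf'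
      rw [eq_of_tablePart_eq htab]
      refine (hg.restrict _).mono (hDD' n hn2) ?_
      rw [pow_mul]
      exact Nat.pow_le_pow_left (mul_add_one_le_pow c hn2) k
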